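/- Let $n\ge 2$ and $m\ge 1$ be integers. Let $\varepsilon_1,\dots,\varepsilon_n$ be the standard basis of $\mathbb{R}^n$ with the standard inner product $\langle\cdot,\cdot\rangle$, and let $V=\{a\in\mathbb{R}^n : a_1+\cdots+a_n=0\}$. For $1\le i\le j\le n-1$ put $\alpha_{ij}=\varepsilon_i-\varepsilon_{j+1}$, and let $\theta=\alpha_{1,n-1}$. For $k\in\mathbb{Z}$ let $H_{\alpha,k}=\{v\in V:\langle v,\alpha\rangle=k\}$. The $m$-Shi arrangement is the set of all hyperplanes $H_{\alpha_{ij},k}$ with $1\le i\le j\le n-1$ and $-m<k\le m$. Its regions are the connected components of the complement in $V$ of the union of these hyperplanes, and a region is dominant if it is contained in the dominant chamber $\{v\in V:\langle v,\alpha_{ii}\rangle\ge 0 \text{ for } 1\le i\le n-1\}$. Let $A_0$ be the fundamental alcove, that is, the interior of $\{v\in V:\langle v,\theta\rangle\le 1,\ \langle v,\alpha_{ii}\rangle\ge 0\text{ for }1\le i\le n-1\}$. A hyperplane $H_{\alpha,k}$ separates two open sets if one of them lies in $\{v\in V:\langle v,\alpha\rangle\ge k\}$ and the other in $\{v\in V:\langle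 v,\alpha\rangle\le k\}$. A separating wall of a region $R$ is a hyperplane of the arrangement that supports a facet of $R$ and separates $R$ from $A_0$. For a dominant region $R$ put $$c(R)=\#\{(i,k): 1\le i\le n-1,\ 1\le k\le m,\ H_{\alpha_{i,n-1},k}\text{ separates }R\text{ from }A_0\},$$ $$r(R)=\#\{(j,k): 1\le j\le n-1,\ 1\le k\le m,\ H_{\alpha_{1j},k}\text{ separates }R\text{ from }A_0\}.$$ Then only finitely many dominant regions of the $m$-Shi arrangement have $H_{\theta,m}$ as a separating wall, and $$\sum_{R} p^{c(R)}q^{r(R)} = p^m q^m\,[m]_{p,q}^{\,n-2},\qquad [m]_{p,q}=\sum_{j=0}^{m-1}p^{j}q^{m-1-j},$$ where the sum is over all dominant regions $R$ of the $m$-Shi arrangement that have $H_{\theta,m}$ as a separating wall. The identity holds for indeterminates $p,q$, equivalently for all elements $p,q$ of any commutative semiring. -/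

import Mathlib

namespace Shi

/-- The ambient Euclidean space `ℝⁿ`. -/
abbrev Amb (n : ℕ) : Type := EuclideanSpace ℝ (Fin n)

/-- The subspace of `ℝⁿ` of vectors whose coordinates sum to zero. -/
def sumZero (n : ℕ) : Submodule ℝ (Amb n) where
  carrier := {a | ∑ i, a i = 0}
  zero_mem' := by simp
  add_mem' := by
    intro a b ha hb
    simp only [Set.mem_ofPred_eq] at ha hb ⊢
    simp [Finset.sum_add_distrib, ha, hb]
  smul_mem' := by
    intro c a ha
    simp only [Set.mem_ofPred_eq] at ha ⊢
    simp [← Finset.mul_sum, ha]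

/-- The space `V` in which the arrangements live. -/
abbrev V (n : ℕ) : Type := sumZero n

/-- The standard basis vector `ε_i` of `ℝⁿ`, with the `1`-based index `1 ≤ i ≤ n`. -/
noncomputable def stdVec (n i : ℕ) : Amb n :=
  WithLp.toLp 2 (fun x : Fin n => if (x : ℕ) + 1 = i then (1 : ℝ) else 0)

/-- The positive root `α_{ij} = α_i + ⋯ + α_j = ε_i - ε_{j+1}`, for `1 ≤ i ≤ j ≤ n - 1`.
The simple roots are the `α_{ii}`. -/
noncomputable def root (n i j : ℕ) : Amb n := stdVec n i - stdVec n (j + 1)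

/-- The highest root `θ = α_{1,n-1}`. -/
noncomputable def highestRoot (n : ℕ) : Amb n := root n 1 (n - 1)

/-- The hyperplane `H_{α,k} = {v ∈ V | ⟨v, α⟩ = k}`. -/
def hyperplane {n : ℕ} (α : Amb n) (k : ℤ) : Set (V n) :=
  {v | inner ℝ (v : Amb n) α = (k : ℝ)}

/-- The closed half-space `{v ∈ V | ⟨v, α⟩ ≥ k}`. -/
def halfGE {n : ℕ} (α : Amb n) (k : ℤ) : Set (V n) :=
  {v | (k : ℝ) ≤ inner ℝ (v : Amb n) α}

/-- The closed half-space `{v ∈ V | ⟨v, α⟩ ≤ k}`. -/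
def halfLE {n : ℕ} (α : Amb n) (k : ℤ) : Set (V n) :=
  {v | inner ℝ (v : Amb n) α ≤ (k : ℝ)}

/-- The `m`-Shi arrangement: all `H_{α,k}` with `α` a positive root and `-m < k ≤ m`. -/
def arrangement (n m : ℕ) : Set (Set (V n)) :=
  {H | ∃ i j : ℕ, 1 ≤ i ∧ i ≤ j ∧ j ≤ n - 1 ∧
    ∃ k : ℤ, -(m : ℤ) < k ∧ k ≤ (m : ℤ) ∧ H = hyperplane (root n i j) k}

/-- The complement in `V` of the union of the hyperplanes of the `m`-Shi arrangement. -/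
def arrCompl (n m : ℕ) : Set (V n) := (⋃₀ arrangement n m)ᶜ

/-- A region is a connected component of the complement of the arrangement. -/
def IsRegion (n m : ℕ) (R : Set (V n)) : Prop :=
  ∃ v ∈ arrCompl n m, R = connectedComponentIn (arrCompl n m) v

/-- The (closed) dominant chamber. -/
def dominantChamber (n : ℕ) : Set (V n) :=
  ⋂ i ∈ Set.Icc 1 (n - 1), halfGE (root n i i) 0

/-- The dominant regions of the `m`-Shi arrangement. -/
def dominantRegions (n m : ℕ) : Set (Set (V n)) :=
  {R | IsRegion n m R ∧ R ⊆ dominantChamber n}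

/-- The fundamental alcove `A₀`. -/
def fundAlcove (n : ℕ) : Set (V n) :=
  interior (halfLE (highestRoot n) 1 ∩ dominantChamber n)

/-- `R` and `S` lie in different closed half-spaces bounded by `H_{α,k}`. -/
def Separates {n : ℕ} (α : Amb n) (k : ℤ) (R S : Set (V n)) : Prop :=
  (R ⊆ halfGE α k ∧ S ⊆ halfLE α k) ∨ (R ⊆ halfLE α k ∧ S ⊆ halfGE α k)

/-- `H_{α,k}` is a wall of `R`: it belongs to the arrangement and supports a facet of `R`, i.e.
`R` lies on one side of it and `closure R ∩ H_{α,k}` is of full dimension in `H_{α,k}`. -/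
def IsWall (n m : ℕ) (α : Amb n) (k : ℤ) (R : Set (V n)) : Prop :=
  hyperplane α k ∈ arrangement n m ∧
  (R ⊆ halfGE α k ∨ R ⊆ halfLE α k) ∧
  (affineSpan ℝ (closure R ∩ hyperplane α k) : Set (V n)) = hyperplane α k

/-- A separating wall of `R` is a wall of `R` which separates `R` from `A₀`. -/
def IsSepWall (n m : ℕ) (α : Amb n) (k : ℤ) (R : Set (V n)) : Prop :=
  IsWall n m α k R ∧ Separates α k R (fundAlcove n)

/-- The dominant regions of the `m`-Shi arrangement having `H_{α,k}` as a separating wall. -/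
def sepSet (n m : ℕ) (α : Amb n) (k : ℤ) : Set (Set (V n)) :=
  {R | R ∈ dominantRegions n m ∧ IsSepWall n m α k R}

/-- `r(R)`: the number of pairs `(j,k)` with `1 ≤ j ≤ n - 1`, `1 ≤ k ≤ m` such that
`H_{α_{1j},k}` separates `R` from `A₀`. -/
noncomputable def rStat (n m : ℕ) (R : Set (V n)) : ℕ :=
  Set.ncard {x : ℕ × ℕ | (1 ≤ x.1 ∧ x.1 ≤ n - 1) ∧ (1 ≤ x.2 ∧ x.2 ≤ m) ∧
    Separates (root n 1 x.1) (x.2 : ℤ) R (fundAlcove n)}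

/-- `c(R)`: the number of pairs `(i,k)` with `1 ≤ i ≤ n - 1`, `1 ≤ k ≤ m` such that
`H_{α_{i,n-1},k}` separates `R` from `A₀`. -/
noncomputable def cStat (n m : ℕ) (R : Set (V n)) : ℕ :=
  Set.ncard {x : ℕ × ℕ | (1 ≤ x.1 ∧ x.1 ≤ n - 1) ∧ (1 ≤ x.2 ∧ x.2 ≤ m) ∧
    Separates (root n x.1 (n - 1)) (x.2 : ℤ) R (fundAlcove n)}

/-- The generating function `F^n_{α,m}(p,q)`, the sum of `p^{c(R)} q^{r(R)}` over the dominant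
regions `R` of the `m`-Shi arrangement having `H_{α,m}` as a separating wall. -/
noncomputable def genFun {A : Type*} [CommSemiring A] (n m : ℕ) (α : Amb n) (p q : A) : A :=
  ∑ᶠ R ∈ sepSet n m α (m : ℤ), p ^ cStat n m R * q ^ rStat n m R

/-- `[k]_{p,q} = ∑_{j=0}^{k-1} p^j q^{k-1-j}`. -/
def pqInt {A : Type*} [CommSemiring A] (k : ℕ) (p q : A) : A :=
  ∑ j ∈ Finset.range k, p ^ j * q ^ (k - 1 - j)

end Shi

namespace Shi

/-! Regions are the cells cut out by strict inequalities on the differences `gap v a b`. A cell has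
`H_{θ,m}` as a dominant separating wall exactly when it lies just above a point `u` of that
hyperplane which is strictly dominant and on no other hyperplane of the arrangement
(`IsFacetPoint.mem_sepSet`, `exists_facetPoint_of_mem_sepSet`). Since `cell` counts points on a
hyperplane as above it, the region is `cell m u` itself.

Put `N = n - 2`. Such a `u` is given by the increasing values of `α_{1,t}`, `t < N`, in `(0, m)`.
Their integer parts `f t` lie in `{0, …, m-1}`, and the fractional parts are nonzero and distinct.
The cell depends only on `f` and on the order of the fractional parts (`HasCode.cell_eq_iff`).
Listing the integer parts by increasing fractional part gives a word in `Fin N → Fin m`; sorting the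
values `w s + (s+1)/(N+1)` inverts this, so every word occurs exactly once (`sepSet_eq_range`,
`cell_wordPoint_injective`).

A value with integer part `f t` contributes `f t` to `r`; its complement to `m` contributes `m - 1 -
f t` to `c`; the root `θ` contributes `m` to each. The weight is thus a product over letters, and
the sum over words is a power. -/

variable {n m : ℕ}

/-! ### Coordinate differences on `V`. -/

/-- The value `v_a - v_b` of the root `ε_a - ε_b` on `v`, with `0`-based indices. -/
def gap (v : V n) (a b : Fin n) : ℝ := (v : Amb n) a - (v : Amb n) b

lemma inner_stdVec (v : Amb n) (a : Fin n) : inner ℝ v (stdVec n (a + 1)) = v a := by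
  simp [stdVec, PiLp.inner_apply, Fin.val_inj]

lemma inner_root (v : V n) (a b : Fin n) :
    inner ℝ (v : Amb n) (root n (a + 1) b) = gap v a b := by
  rw [root, inner_sub_right, inner_stdVec, inner_stdVec, gap]

lemma continuous_gap (a b : Fin n) : Continuous fun v : V n => gap v a b := by
  unfold gap
  fun_prop

lemma gap_self (v : V n) (a : Fin n) : gap v a a = 0 := sub_self _

lemma gap_add_gap (v : V n) (a b c : Fin n) : gap v a b + gap v b c = gap v a c := by
  simp [gap]

lemma gap_add (v w : V n) (a b : Fin n) : gap (v + w) a b = gap v a b + gap w a b := by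
  simp [gap]; ring

lemma gap_smul (t : ℝ) (v : V n) (a b : Fin n) : gap (t • v) a b = t * gap v a b := by
  simp [gap]; ring

lemma gap_sub (v w : V n) (a b : Fin n) : gap (v - w) a b = gap v a b - gap w a b := by
  simp [gap]; ring

/-- The projection of `x` to `V` along the all-ones vector. -/
noncomputable def centre (x : Fin n → ℝ) : V n :=
  ⟨WithLp.toLp 2 fun a => x a - (∑ b, x b) / n, by
    rcases n with _ | n
    · simp [sumZero]
    · simp only [sumZero, Submodule.mem_mk, AddSubmonoid.mem_mk, AddSubsemigroup.mem_mk,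
        Set.mem_ofPred_eq, Finset.sum_sub_distrib, Finset.sum_const, Finset.card_univ,
        Fintype.card_fin, nsmul_eq_mul]
      field_simp
      simp⟩

lemma gap_centre (x : Fin n → ℝ) (a b : Fin n) : gap (centre x) a b = x a - x b := by
  simp [gap, centre]

/-! ### Regions as cells. -/

/-- The points of `V` lying, for every hyperplane of the arrangement, strictly on the same side as
`u`, where a point on the hyperplane counts as lying on the upper side. -/
def cell (m : ℕ) (u : V n) : Set (V n) :=
  {v | ∀ a b : Fin n, a < b → ∀ k : ℤ, -(m : ℤ) < k → k ≤ m →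
    ((k : ℝ) ≤ gap u a b → (k : ℝ) < gap v a b) ∧ (gap u a b < k → gap v a b < k)}

lemma hyperplane_root (a b : Fin n) (k : ℤ) :
    hyperplane (root n (a + 1) b) k = {v : V n | gap v a b = k} := by
  ext v; simp [hyperplane, inner_root v]

lemma exists_fin_of_root {i j : ℕ} (hi : 1 ≤ i) (hij : i ≤ j) (hj : j ≤ n - 1) :
    ∃ a b : Fin n, a < b ∧ i = a + 1 ∧ j = b :=
  ⟨⟨i - 1, by omega⟩, ⟨j, by omega⟩, by simp [Fin.lt_def]; omega, by simp; omega, rfl⟩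

lemma mem_arrangement_iff {H : Set (V n)} : H ∈ arrangement n m ↔
    ∃ a b : Fin n, a < b ∧ ∃ k : ℤ, -(m : ℤ) < k ∧ k ≤ m ∧ H = {v : V n | gap v a b = k} := by
  constructor
  · rintro ⟨i, j, hi, hij, hj, k, hk, hk', rfl⟩
    obtain ⟨a, b, hab, rfl, rfl⟩ := exists_fin_of_root hi hij hj
    exact ⟨a, b, hab, k, hk, hk', hyperplane_root a b k⟩
  · rintro ⟨a, b, hab, k, hk, hk', rfl⟩
    have hab' : (a : ℕ) < b := hab
    exact ⟨a + 1, b, by omega, by omega, by omega, k, hk, hk', (hyperplane_root a b k).symm⟩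

lemma mem_arrCompl_iff {v : V n} : v ∈ arrCompl n m ↔
    ∀ a b : Fin n, a < b → ∀ k : ℤ, -(m : ℤ) < k → k ≤ m → gap v a b ≠ k := by
  simp only [arrCompl, Set.mem_compl_iff, Set.mem_sUnion, mem_arrangement_iff, not_exists, not_and]
  constructor
  · intro h a b hab k hk hk' he
    exact h _ ⟨a, b, hab, k, hk, hk', rfl⟩ he
  · rintro h _ ⟨a, b, hab, k, hk, hk', rfl⟩ he
    exact h a b hab k hk hk' he

lemma cell_subset_arrCompl (u : V n) : cell m u ⊆ arrCompl n m := by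
  intro v hv
  rw [mem_arrCompl_iff]
  intro a b hab k hk hk' he
  have := hv a b hab k hk hk'
  rcases le_or_gt (k : ℝ) (gap u a b) with h | h
  · exact (this.1 h).ne' he
  · exact (this.2 h).ne he

lemma mem_cell_self {v : V n} (hv : v ∈ arrCompl n m) : v ∈ cell m v := fun a b hab k hk hk' =>
  ⟨fun h => lt_of_le_of_ne h (mem_arrCompl_iff.1 hv a b hab k hk hk').symm, id⟩

/-- A point satisfying the closed inequalities of a cell is joined to the cell by a segment. -/
lemma add_smul_mem_cell {u v y : V n} (hv : v ∈ cell m u)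
    (hy : ∀ a b : Fin n, a < b → ∀ k : ℤ, -(m : ℤ) < k → k ≤ m →
      ((k : ℝ) ≤ gap u a b → (k : ℝ) ≤ gap y a b) ∧ (gap u a b < k → gap y a b ≤ k))
    {s t : ℝ} (hs : 0 ≤ s) (ht : 0 < t) (hst : s + t = 1) : s • y + t • v ∈ cell m u := by
  intro a b hab k hk hk'
  obtain ⟨h1, h2⟩ := hv a b hab k hk hk'
  obtain ⟨h3, h4⟩ := hy a b hab k hk hk'
  rw [gap_add, gap_smul, gap_smul]
  have e : (k : ℝ) = s * k + t * k := by rw [← add_mul, hst, one_mul]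
  constructor
  · intro h
    have := mul_lt_mul_of_pos_left (h1 h) ht
    have := mul_le_mul_of_nonneg_left (h3 h) hs
    linarith
  · intro h
    have := mul_lt_mul_of_pos_left (h2 h) ht
    have := mul_le_mul_of_nonneg_left (h4 h) hs
    linarith

lemma convex_cell (u : V n) : Convex ℝ (cell m u) := by
  intro y hy v hv s t hs ht hst
  rcases ht.eq_or_lt with rfl | ht
  · obtain rfl : s = 1 := by linarith
    simpa using hy
  · exact add_smul_mem_cell hv (fun a b hab k hk hk' =>
      ⟨fun h => ((hy a b hab k hk hk').1 h).le, fun h => ((hy a b hab k hk hk').2 h).le⟩) hs ht hst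

/-- On a component each `gap` takes an interval of values that avoids every level `k`, so no
hyperplane is crossed. Conversely a cell is convex and misses the arrangement. -/
lemma connectedComponentIn_eq_cell {v : V n} (hv : v ∈ arrCompl n m) :
    connectedComponentIn (arrCompl n m) v = cell m v := by
  apply Set.Subset.antisymm
  · intro w hw a b hab k hk hk'
    have hpre : IsPreconnected ((fun x : V n => gap x a b) ''
        connectedComponentIn (arrCompl n m) v) :=
      isPreconnected_connectedComponentIn.image _ (continuous_gap a b).continuousOn
    have hne : (k : ℝ) ∉ (fun x : V n => gap x a b) '' connectedComponentIn (arrCompl n m) v := by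
      rintro ⟨x, hx, hxk⟩
      exact mem_arrCompl_iff.1 (connectedComponentIn_subset _ _ hx) a b hab k hk hk' hxk
    have hv' := Set.mem_image_of_mem (fun x : V n => gap x a b) (mem_connectedComponentIn hv)
    have hw' := Set.mem_image_of_mem (fun x : V n => gap x a b) hw
    constructor
    · intro h
      by_contra! h'
      exact hne (hpre.ordConnected.out hw' hv' ⟨h', h⟩)
    · intro h
      by_contra! h'
      exact hne (hpre.ordConnected.out hv' hw' ⟨h.le, h'⟩)
  · exact (convex_cell v).isPreconnected.subset_connectedComponentIn (mem_cell_self hv)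
      (cell_subset_arrCompl v)

lemma isRegion_iff {R : Set (V n)} : IsRegion n m R ↔ ∃ v ∈ arrCompl n m, R = cell m v := by
  refine exists_congr fun v => and_congr_right fun hv => ?_
  rw [connectedComponentIn_eq_cell hv]

/-- Cells only depend on the side of each hyperplane on which the point lies. -/
lemma cell_congr {u v : V n} (h : ∀ a b : Fin n, a < b → ∀ k : ℤ, -(m : ℤ) < k → k ≤ m →
    ((k : ℝ) ≤ gap u a b ↔ (k : ℝ) ≤ gap v a b)) : cell m u = cell m v := by
  ext w
  simp only [cell, Set.mem_ofPred_eq]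
  refine forall_congr' fun a => forall_congr' fun b => forall_congr' fun hab => forall_congr' fun k =>
    forall_congr' fun hk => forall_congr' fun hk' => ?_
  rw [← not_le, ← not_le, h a b hab k hk hk', not_le, not_le]

lemma le_gap_iff_of_mem_cell {u v : V n} (hv : v ∈ cell m u) {a b : Fin n} (hab : a < b) {k : ℤ}
    (hk : -(m : ℤ) < k) (hk' : k ≤ m) : (k : ℝ) ≤ gap v a b ↔ (k : ℝ) ≤ gap u a b := by
  obtain ⟨h1, h2⟩ := hv a b hab k hk hk'
  refine ⟨fun h => ?_, fun h => (h1 h).le⟩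
  by_contra! h'
  exact absurd (h2 h') h.not_gt

lemma cell_eq_of_mem {u v : V n} (hv : v ∈ cell m u) : cell m v = cell m u :=
  cell_congr fun _ _ hab _ hk hk' => le_gap_iff_of_mem_cell hv hab hk hk'

lemma isRegion_cell {u : V n} (h : (cell m u).Nonempty) : IsRegion n m (cell m u) := by
  obtain ⟨v, hv⟩ := h
  exact isRegion_iff.2 ⟨v, cell_subset_arrCompl u hv, (cell_eq_of_mem hv).symm⟩

/-! ### Dominance and separation from the fundamental alcove. -/

/-- Every gap of a dominant vector is nonnegative. -/
lemma mem_dominantChamber_iff {v : V n} :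
    v ∈ dominantChamber n ↔ ∀ a b : Fin n, a < b → 0 ≤ gap v a b := by
  rcases n with _ | n
  · simp [dominantChamber]
  have key : v ∈ dominantChamber (n + 1) ↔ ∀ a : Fin n, 0 ≤ gap v a.castSucc a.succ := by
    simp only [dominantChamber, Set.mem_iInter, halfGE, Set.mem_ofPred_eq]
    constructor
    · intro h a
      have := h (a + 1) ⟨by omega, by omega⟩
      have e := inner_root v a.castSucc a.succ
      simp only [Fin.val_castSucc, Fin.val_succ] at e
      rw [e] at this
      simpa using this
    · rintro h i ⟨hi, hi'⟩
      have := h ⟨i - 1, by omega⟩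
      have e := inner_root v (⟨i - 1, by omega⟩ : Fin n).castSucc
        (⟨i - 1, by omega⟩ : Fin n).succ
      simp only [Fin.val_castSucc, Fin.val_succ, Nat.sub_add_cancel hi] at e
      rw [e]
      simpa using this
  rw [key]
  constructor
  · intro h a b hab
    have : Antitone fun a => (v : Amb (n + 1)) a :=
      Fin.antitone_iff_succ_le.2 fun i => sub_nonneg.1 (h i)
    exact sub_nonneg.2 (this hab.le)
  · intro h a
    exact h _ _ a.castSucc_lt_succ

lemma gap_pos_of_mem_dominantChamber (hm : 1 ≤ m) {v : V n} (hv : v ∈ dominantChamber n)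
    (hv' : v ∈ arrCompl n m) {a b : Fin n} (hab : a < b) : 0 < gap v a b := by
  refine lt_of_le_of_ne (mem_dominantChamber_iff.1 hv a b hab) ?_
  have := mem_arrCompl_iff.1 hv' a b hab 0 (by omega) (by omega)
  simpa using this.symm

lemma cell_subset_dominantChamber (hm : 1 ≤ m) {u : V n}
    (hu : ∀ a b : Fin n, a < b → 0 ≤ gap u a b) : cell m u ⊆ dominantChamber n := by
  intro v hv
  rw [mem_dominantChamber_iff]
  intro a b hab
  have := ((hv a b hab 0 (by omega) (by omega)).1 (by simpa using hu a b hab)).le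
  simpa using this

lemma gap_mono {v : V n} (hv : ∀ a b : Fin n, a < b → 0 ≤ gap v a b) {a b c d : Fin n}
    (hca : c ≤ a) (hbd : b ≤ d) : gap v a b ≤ gap v c d := by
  have h : ∀ {a b : Fin n}, a ≤ b → 0 ≤ gap v a b := fun {a b} hab => by
    rcases hab.eq_or_lt with rfl | hab
    · exact (gap_self v a).ge
    · exact hv a b hab
  have h1 := h hca
  have h2 := h hbd
  rw [← gap_add_gap v c a d, ← gap_add_gap v a b d]
  linarith

lemma highestRoot_eq (N : ℕ) :
    highestRoot (N + 2) = root (N + 2) ((0 : Fin (N + 2)) + 1) (Fin.last (N + 1)) := by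
  simp [highestRoot]

lemma gap_le_one_of_mem_fundAlcove {N : ℕ} {v : V (N + 2)} (hv : v ∈ fundAlcove (N + 2))
    (a b : Fin (N + 2)) : gap v a b ≤ 1 := by
  obtain ⟨h1, h2⟩ := interior_subset hv
  rw [mem_dominantChamber_iff] at h2
  rw [halfLE, Set.mem_ofPred_eq, highestRoot_eq, inner_root] at h1
  exact (gap_mono h2 (Fin.zero_le a) (Fin.le_last b)).trans (by simpa using h1)

lemma exists_mem_fundAlcove (N : ℕ) :
    ∃ v ∈ fundAlcove (N + 2), ∀ a b : Fin (N + 2), gap v a b < 1 := by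
  -- Equally spaced coordinates: the largest gap is `(N+1)/(N+2) < 1`.
  set v : V (N + 2) := centre fun a => -(a : ℝ) / (N + 2)
  have hv : ∀ a b, gap v a b = ((b : ℝ) - a) / (N + 2) := fun a b => by
    rw [gap_centre]; ring
  have hpos : ∀ a b, a < b → 0 < gap v a b := fun a b hab => by
    rw [hv]
    have : (a : ℝ) < b := by exact_mod_cast hab
    exact div_pos (by linarith) (by positivity)
  have hlt : ∀ a b, gap v a b < 1 := fun a b => by
    rw [hv, div_lt_one (by positivity)]
    have : (b : ℝ) < N + 2 := by exact_mod_cast b.2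
    have : (0 : ℝ) ≤ (a : ℕ) := by positivity
    linarith
  refine ⟨v, ?_, hlt⟩
  have ho : IsOpen {w : V (N + 2) | (∀ a b, a < b → 0 < gap w a b) ∧
      gap w 0 (Fin.last (N + 1)) < 1} := by
    rw [Set.ofPred_and]
    refine IsOpen.inter ?_ (isOpen_lt (continuous_gap _ _) continuous_const)
    simp only [Set.ofPred_forall]
    exact isOpen_iInter_of_finite fun a => isOpen_iInter_of_finite fun b =>
      isOpen_iInter_of_finite fun _ => isOpen_lt continuous_const (continuous_gap _ _)
  refine mem_interior.2 ⟨_, fun w hw => ⟨?_, ?_⟩, ho, hpos, hlt _ _⟩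
  · rw [halfLE, Set.mem_ofPred_eq, highestRoot_eq, inner_root]
    simpa using hw.2.le
  · exact mem_dominantChamber_iff.2 fun a b hab => (hw.1 a b hab).le

/-- Only one orientation is possible: `A₀` contains a point whose gaps are all below `1 ≤ k`. -/
lemma separates_fundAlcove_iff {N : ℕ} {a b : Fin (N + 2)} {k : ℤ} (hk : 1 ≤ k)
    {R : Set (V (N + 2))} : Separates (root (N + 2) (a + 1) b) k R (fundAlcove (N + 2)) ↔
      ∀ v ∈ R, (k : ℝ) ≤ gap v a b := by
  have hk1 : (1 : ℝ) ≤ k := by exact_mod_cast hk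
  have hGE : R ⊆ halfGE (root (N + 2) (a + 1) b) k ↔ ∀ v ∈ R, (k : ℝ) ≤ gap v a b := by
    simp only [halfGE, inner_root]; rfl
  rw [Separates, hGE]
  refine ⟨?_, fun h => Or.inl ⟨h, fun v hv => ?_⟩⟩
  · rintro (⟨h, -⟩ | ⟨-, h⟩)
    · exact h
    · obtain ⟨v, hv, hlt⟩ := exists_mem_fundAlcove N
      have := h hv
      rw [halfGE, Set.mem_ofPred_eq, inner_root] at this
      linarith [hlt a b]
  · rw [halfLE, Set.mem_ofPred_eq, inner_root]
    exact (gap_le_one_of_mem_fundAlcove hv a b).trans hk1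

lemma separates_cell_iff {N : ℕ} {u : V (N + 2)} (hu : (cell m u).Nonempty) {a b : Fin (N + 2)}
    (hab : a < b) {k : ℤ} (hk : 1 ≤ k) (hk' : k ≤ m) :
    Separates (root (N + 2) (a + 1) b) k (cell m u) (fundAlcove (N + 2)) ↔
      (k : ℝ) ≤ gap u a b := by
  rw [separates_fundAlcove_iff hk]
  refine ⟨fun h => ?_, fun h v hv => ((hv a b hab k (by omega) hk').1 h).le⟩
  obtain ⟨v, hv⟩ := hu
  exact (le_gap_iff_of_mem_cell hv hab (by omega) hk').1 (h v hv)

/-! ### Facet points on `H_{θ,m}`. -/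

/-- A point in the relative interior of a dominant facet on `H_{θ,m}`. -/
structure IsFacetPoint {N : ℕ} (m : ℕ) (u : V (N + 2)) : Prop where
  gap_eq : gap u 0 (Fin.last (N + 1)) = m
  gap_pos : ∀ a b : Fin (N + 2), a < b → 0 < gap u a b
  gap_ne : ∀ a b : Fin (N + 2), a < b → ∀ k : ℤ, -(m : ℤ) < k → k ≤ m →
    ¬(a = 0 ∧ b = Fin.last (N + 1) ∧ k = m) → gap u a b ≠ k

section FacetPoint

variable {N : ℕ} {u : V (N + 2)}

/-- A small push from `u` in a direction that increases `θ` makes the one equality strict. The other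
inequalities are strict at `u` and finite in number, so they survive. -/
lemma IsFacetPoint.cell_nonempty (hu : IsFacetPoint m u) : (cell m u).Nonempty := by
  set d : V (N + 2) := centre fun a => -(a : ℝ)
  have hd : 0 < gap d 0 (Fin.last (N + 1)) := by
    rw [gap_centre]; simp; positivity
  have hlim : ∀ a b, Filter.Tendsto (fun t : ℝ => gap (u + t • d) a b) (nhdsWithin 0 (Set.Ioi 0))
      (nhds (gap u a b)) := fun a b => by
    have : Continuous fun t : ℝ => gap (u + t • d) a b := (continuous_gap a b).comp (by fun_prop)
    simpa using (this.tendsto 0).mono_left nhdsWithin_le_nhds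
  have hev : ∀ᶠ t : ℝ in nhdsWithin 0 (Set.Ioi 0), ∀ a b : Fin (N + 2), ∀ k ∈ Set.Ioc (-(m : ℤ)) m,
      a < b → ((k : ℝ) ≤ gap u a b → (k : ℝ) < gap (u + t • d) a b) ∧
        (gap u a b < k → gap (u + t • d) a b < k) := by
    refine Filter.eventually_all.2 fun a => Filter.eventually_all.2 fun b =>
      ((Set.finite_Ioc _ _).eventually_all).2 fun k hk => ?_
    by_cases hab : a < b
    swap
    · exact Filter.Eventually.of_forall fun t h => absurd h hab
    by_cases hθ : a = 0 ∧ b = Fin.last (N + 1) ∧ k = m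
    · obtain ⟨rfl, rfl, rfl⟩ := hθ
      filter_upwards [self_mem_nhdsWithin] with t ht _
      have := mul_pos (Set.mem_Ioi.1 ht) hd
      rw [gap_add, gap_smul, hu.gap_eq]
      push_cast
      exact ⟨fun _ => by linarith, fun h => absurd h (lt_irrefl _)⟩
    · have hne := hu.gap_ne a b hab k hk.1 hk.2 hθ
      rcases hne.lt_or_gt with h | h
      · filter_upwards [(hlim a b).eventually_lt_const h] with t ht _
        exact ⟨fun h' => absurd h' h.not_ge, fun _ => ht⟩
      · filter_upwards [(hlim a b).eventually_const_lt h] with t ht _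
        exact ⟨fun _ => ht, fun h' => absurd h' h.not_gt⟩
  obtain ⟨t, ht⟩ := hev.exists
  exact ⟨u + t • d, fun a b hab k hk hk' => ht a b k ⟨hk, hk'⟩ hab⟩

lemma mem_closure_cell {y : V n} {u : V n} (hu : (cell m u).Nonempty)
    (hy : ∀ a b : Fin n, a < b → ∀ k : ℤ, -(m : ℤ) < k → k ≤ m →
      ((k : ℝ) ≤ gap u a b → (k : ℝ) ≤ gap y a b) ∧ (gap u a b < k → gap y a b ≤ k)) :
    y ∈ closure (cell m u) := by
  obtain ⟨v, hv⟩ := hu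
  have hc : Continuous fun t : ℝ => (1 - t) • y + t • v := by fun_prop
  have hlim : Filter.Tendsto (fun t : ℝ => (1 - t) • y + t • v) (nhdsWithin 0 (Set.Ioi 0))
      (nhds y) := by
    simpa using (hc.tendsto 0).mono_left nhdsWithin_le_nhds
  refine mem_closure_of_tendsto hlim ?_
  filter_upwards [Ioo_mem_nhdsGT (zero_lt_one' ℝ)] with t ht
  exact add_smul_mem_cell hv hy (by linarith [ht.2]) ht.1 (by ring)

/-- For the span condition: inside `H_{θ,m}`, points near `u` still satisfy all closed inequalities
of the cell, so the facet contains a neighbourhood of `u` in the hyperplane. -/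
lemma IsFacetPoint.mem_sepSet (hm : 1 ≤ m) (hu : IsFacetPoint m u) :
    cell m u ∈ sepSet (N + 2) m (highestRoot (N + 2)) m := by
  have hne := hu.cell_nonempty
  have hlast : (0 : Fin (N + 2)) < Fin.last (N + 1) := Fin.last_pos
  refine ⟨⟨isRegion_cell hne, cell_subset_dominantChamber hm fun a b hab => (hu.gap_pos a b hab).le⟩,
    ⟨?_, ?_, ?_⟩, ?_⟩
  · rw [highestRoot_eq, hyperplane_root]
    exact mem_arrangement_iff.2 ⟨0, Fin.last _, hlast, m, by omega, le_rfl, rfl⟩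
  · left
    intro v hv
    rw [halfGE, Set.mem_ofPred_eq, highestRoot_eq, inner_root]
    exact ((hv _ _ hlast m (by omega) le_rfl).1 (by rw [hu.gap_eq]; rfl)).le
  · rw [highestRoot_eq, hyperplane_root]
    have humem : u ∈ closure (cell m u) := mem_closure_cell hne fun a b hab k hk hk' => ⟨id, le_of_lt⟩
    apply Set.Subset.antisymm
    · set F : AffineSubspace ℝ (V (N + 2)) :=
        { carrier := {v | gap v 0 (Fin.last (N + 1)) = ((m : ℤ) : ℝ)}
          smul_vsub_vadd_mem' := by
            intro c p q r hp hq hr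
            simp only [Set.mem_ofPred_eq, vsub_eq_sub, vadd_eq_add, gap_add, gap_smul,
              gap_sub] at *
            rw [hp, hq, hr]; ring }
      have : affineSpan ℝ (closure (cell m u) ∩ {v | gap v 0 (Fin.last (N + 1)) = ((m : ℤ) : ℝ)})
          ≤ F := affineSpan_le.2 Set.inter_subset_right
      exact this
    · intro h hh
      set y : ℝ → V (N + 2) := fun t => AffineMap.lineMap u h t
      have hy : ∀ t a b, gap (y t) a b = gap u a b + t * (gap h a b - gap u a b) := fun t a b => by
        simp only [y, AffineMap.lineMap_apply, vsub_eq_sub, vadd_eq_add, gap_add, gap_smul,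
          gap_sub]
        ring
      have hyθ : ∀ t, gap (y t) 0 (Fin.last (N + 1)) = ((m : ℤ) : ℝ) := fun t => by
        rw [hy, hh, hu.gap_eq]; simp
      have hlim : ∀ a b, Filter.Tendsto (fun t : ℝ => gap (y t) a b) (nhdsWithin 0 (Set.Ioi 0))
          (nhds (gap u a b)) := fun a b => by
        have : Continuous fun t : ℝ => gap (y t) a b := by simp only [hy]; fun_prop
        have h0 := (this.tendsto 0).mono_left (nhdsWithin_le_nhds (s := Set.Ioi 0))
        simpa [hy] using h0
      have hev : ∀ᶠ t : ℝ in nhdsWithin 0 (Set.Ioi 0), ∀ a b : Fin (N + 2),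
          ∀ k ∈ Set.Ioc (-(m : ℤ)) m, a < b →
          ((k : ℝ) ≤ gap u a b → (k : ℝ) ≤ gap (y t) a b) ∧ (gap u a b < k → gap (y t) a b ≤ k) := by
        refine Filter.eventually_all.2 fun a => Filter.eventually_all.2 fun b =>
          ((Set.finite_Ioc _ _).eventually_all).2 fun k hk => ?_
        by_cases hab : a < b
        swap
        · exact Filter.Eventually.of_forall fun t h => absurd h hab
        by_cases hθ : a = 0 ∧ b = Fin.last (N + 1) ∧ k = m
        · obtain ⟨rfl, rfl, rfl⟩ := hθ
          exact Filter.Eventually.of_forall fun t _ => by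
            rw [hyθ]; exact ⟨fun _ => le_rfl, fun _ => le_rfl⟩
        · have hne := hu.gap_ne a b hab k hk.1 hk.2 hθ
          rcases hne.lt_or_gt with h | h
          · filter_upwards [(hlim a b).eventually_lt_const h] with t ht _
            exact ⟨fun h' => absurd h' h.not_ge, fun _ => ht.le⟩
          · filter_upwards [(hlim a b).eventually_const_lt h] with t ht _
            exact ⟨fun _ => ht.le, fun h' => absurd h' h.not_gt⟩
      obtain ⟨t, ht, ht0⟩ := (hev.and self_mem_nhdsWithin).exists
      have hyt : y t ∈ closure (cell m u) :=
        mem_closure_cell hne fun a b hab k hk hk' => ht a b k ⟨hk, hk'⟩ hab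
      have h1 := subset_affineSpan ℝ _ (show y t ∈ closure (cell m u) ∩
        {v | gap v 0 (Fin.last (N + 1)) = ((m : ℤ) : ℝ)} from ⟨hyt, hyθ t⟩)
      have h2 := subset_affineSpan ℝ _ (show u ∈ closure (cell m u) ∩
        {v | gap v 0 (Fin.last (N + 1)) = ((m : ℤ) : ℝ)} from ⟨humem, by simpa using hu.gap_eq⟩)
      -- Extending the segment from `u` to `y t` by the factor `t⁻¹` recovers `h`.
      have h3 := AffineMap.lineMap_mem t⁻¹ h2 h1
      have : AffineMap.lineMap u (y t) t⁻¹ = h := by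
        simp only [y, AffineMap.lineMap_apply, vsub_eq_sub, vadd_eq_add, add_sub_cancel_right,
          smul_smul]
        rw [inv_mul_cancel₀ (ne_of_gt ht0)]; simp
      rwa [this] at h3
  · rw [highestRoot_eq, separates_cell_iff hne hlast (by omega) le_rfl, hu.gap_eq]
    rfl

/-- If finitely many affine functions are nonnegative on a nonempty convex set and none of them
vanishes identically on it, then they are simultaneously positive at some point of it. -/
lemma exists_forall_pos_of_convex {ι E : Type*} [AddCommGroup E] [Module ℝ E] {C : Set E}
    (hC : Convex ℝ C) (hne : C.Nonempty) (s : Finset ι) (f : ι → E →ᵃ[ℝ] ℝ)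
    (h0 : ∀ i ∈ s, ∀ x ∈ C, 0 ≤ f i x) (h1 : ∀ i ∈ s, ∃ x ∈ C, 0 < f i x) :
    ∃ x ∈ C, ∀ i ∈ s, 0 < f i x := by
  classical
  induction s using Finset.induction_on with
  | empty => exact ⟨hne.some, hne.some_mem, by simp⟩
  | insert i s _ ih =>
    obtain ⟨x, hx, hxs⟩ := ih (fun j hj => h0 j (Finset.mem_insert_of_mem hj))
      fun j hj => h1 j (Finset.mem_insert_of_mem hj)
    obtain ⟨y, hy, hyi⟩ := h1 i (Finset.mem_insert_self i s)
    have hmid : ∀ j, f j (midpoint ℝ x y) = (f j x + f j y) / 2 := fun j => by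
      rw [(f j).map_midpoint, midpoint_eq_smul_add]
      simp only [invOf_eq_inv, smul_eq_mul]; ring
    -- At the midpoint each function averages a nonnegative and a positive value.
    refine ⟨midpoint ℝ x y, hC.midpoint_mem hx hy, fun j hj => ?_⟩
    rw [hmid]
    rcases Finset.mem_insert.1 hj with rfl | hjs
    · have := h0 j hj x hx
      linarith
    · have := h0 j hj y hy
      have := hxs j hjs
      linarith

end FacetPoint

/-- The root `ε_a - ε_b` as a linear functional on `V`. -/
def gapLin (a b : Fin n) : V n →ₗ[ℝ] ℝ where
  toFun v := gap v a b
  map_add' v w := gap_add v w a b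
  map_smul' t v := gap_smul t v a b

/-- The facet `C` is convex and spans `H_{θ,m}`. The auxiliary facet point from `hex` shows that no
other inequality of the cell can be an equality on all of `C`, so some point of `C` makes them all
strict. -/
lemma exists_facetPoint_of_mem_sepSet {N : ℕ} (hm : 1 ≤ m)
    (hex : ∃ u : V (N + 2), IsFacetPoint m u) {R : Set (V (N + 2))}
    (hR : R ∈ sepSet (N + 2) m (highestRoot (N + 2)) m) :
    ∃ u : V (N + 2), IsFacetPoint m u ∧ R = cell m u := by
  obtain ⟨⟨hreg, hdom⟩, ⟨-, -, hspan⟩, hsep⟩ := hR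
  obtain ⟨v, hv, rfl⟩ := isRegion_iff.1 hreg
  have hvm := mem_cell_self hv
  have hlast : (0 : Fin (N + 2)) < Fin.last (N + 1) := Fin.last_pos
  rw [highestRoot_eq, separates_cell_iff ⟨v, hvm⟩ hlast (by omega) le_rfl] at hsep
  have hpos : ∀ a b : Fin (N + 2), a < b → 0 < gap v a b := fun a b hab =>
    gap_pos_of_mem_dominantChamber hm (hdom hvm) hv hab
  rw [highestRoot_eq, hyperplane_root] at hspan
  set C : Set (V (N + 2)) := closure (cell m v) ∩ {w | gap w 0 (Fin.last (N + 1)) = ((m : ℤ) : ℝ)}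
    with hCdef
  obtain ⟨u₀, hu₀⟩ := hex
  have hu₀C : u₀ ∈ affineSpan ℝ C := by
    rw [← SetLike.mem_coe, hspan]; exact hu₀.gap_eq
  have hCne : C.Nonempty := (affineSpan_nonempty ℝ).1 ⟨u₀, hu₀C⟩
  have hCconv : Convex ℝ C := by
    refine (convex_cell v).closure.inter ?_
    intro x hx y hy s t _ _ hst
    simp only [Set.mem_ofPred_eq, gap_add, gap_smul] at *
    rw [hx, hy, ← add_mul, hst, one_mul]
  have hweak : ∀ x ∈ C, ∀ a b : Fin (N + 2), a < b → ∀ k : ℤ, -(m : ℤ) < k → k ≤ m →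
      ((k : ℝ) ≤ gap v a b → (k : ℝ) ≤ gap x a b) ∧ (gap v a b < k → gap x a b ≤ k) := by
    intro x hx a b hab k hk hk'
    constructor
    · intro h
      exact closure_minimal (fun y hy => ((hy a b hab k hk hk').1 h).le)
        (isClosed_le continuous_const (continuous_gap a b)) hx.1
    · intro h
      exact closure_minimal (fun y hy => ((hy a b hab k hk hk').2 h).le)
        (isClosed_le (continuous_gap a b) continuous_const) hx.1
  classical
  set I : Finset (Fin (N + 2) × Fin (N + 2) × ℤ) :=
    (Finset.univ ×ˢ Finset.univ ×ˢ Finset.Ioc (-(m : ℤ)) m).filter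
      (fun i => i.1 < i.2.1 ∧ ¬(i.1 = 0 ∧ i.2.1 = Fin.last (N + 1) ∧ i.2.2 = m)) with hI
  set f : Fin (N + 2) × Fin (N + 2) × ℤ → V (N + 2) →ᵃ[ℝ] ℝ := fun i =>
    if (i.2.2 : ℝ) ≤ gap v i.1 i.2.1 then
      (gapLin i.1 i.2.1).toAffineMap - AffineMap.const ℝ _ (i.2.2 : ℝ)
    else AffineMap.const ℝ _ (i.2.2 : ℝ) - (gapLin i.1 i.2.1).toAffineMap with hf
  have hfx : ∀ i x, f i x = if (i.2.2 : ℝ) ≤ gap v i.1 i.2.1 then gap x i.1 i.2.1 - i.2.2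
      else i.2.2 - gap x i.1 i.2.1 := fun i x => by
    simp only [hf]; split_ifs <;> simp [gapLin]
  have hf0 : ∀ i ∈ I, ∀ x ∈ C, 0 ≤ f i x := by
    rintro ⟨a, b, k⟩ hi x hx
    simp only [hI, Finset.mem_filter, Finset.mem_product, Finset.mem_univ, true_and,
      Finset.mem_Ioc] at hi
    obtain ⟨⟨hk, hk'⟩, hab, -⟩ := hi
    have := hweak x hx a b hab k hk hk'
    rw [hfx]
    split_ifs with h
    · exact sub_nonneg.2 (this.1 h)
    · exact sub_nonneg.2 (this.2 (not_le.1 h))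
  have hf1 : ∀ i ∈ I, ∃ x ∈ C, 0 < f i x := by
    intro i hi
    by_contra! hcon
    have hzero : ∀ x ∈ C, f i x = 0 := fun x hx => le_antisymm (hcon x hx) (hf0 i hi x hx)
    -- An affine function vanishing on `C` vanishes on its span, which contains `u₀`.
    have : f i u₀ = 0 := by
      have hle : affineSpan ℝ C ≤ (affineSpan ℝ {(0 : ℝ)}).comap (f i) :=
        affineSpan_le.2 fun x hx => by simp [hzero x hx]
      simpa using hle hu₀C
    obtain ⟨a, b, k⟩ := i
    simp only [hI, Finset.mem_filter, Finset.mem_product, Finset.mem_univ, true_and,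
      Finset.mem_Ioc] at hi
    obtain ⟨⟨hk, hk'⟩, hab, hθ⟩ := hi
    apply hu₀.gap_ne a b hab k hk hk' hθ
    rw [hfx] at this
    split_ifs at this <;> simp only at this <;> linarith
  obtain ⟨u, huC, hu⟩ := exists_forall_pos_of_convex hCconv hCne I f hf0 hf1
  have huθ : gap u 0 (Fin.last (N + 1)) = m := by simpa using huC.2
  have hstrict : ∀ a b : Fin (N + 2), a < b → ∀ k : ℤ, -(m : ℤ) < k → k ≤ m →
      ¬(a = 0 ∧ b = Fin.last (N + 1) ∧ k = m) →
      ((k : ℝ) ≤ gap v a b → (k : ℝ) < gap u a b) ∧ (gap v a b < k → gap u a b < k) := by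
    intro a b hab k hk hk' hθ
    have := hu (a, b, k) (by simp [hI, hab, hk, hk']; tauto)
    rw [hfx] at this
    constructor
    · intro h
      rw [if_pos h] at this
      exact sub_pos.1 this
    · intro h
      rw [if_neg h.not_ge] at this
      exact sub_pos.1 this
  refine ⟨u, ⟨huθ, fun a b hab => ?_, fun a b hab k hk hk' hθ he => ?_⟩, ?_⟩
  -- Level `0` belongs to the arrangement and differs from `m` because `1 ≤ m`.
  · have := (hstrict a b hab 0 (by omega) (by omega) (by omega)).1 (by simpa using (hpos a b hab).le)
    simpa using this
  · have := hstrict a b hab k hk hk' hθ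
    rcases le_or_gt (k : ℝ) (gap v a b) with h | h
    · exact (this.1 h).ne' he
    · exact (this.2 h).ne he
  · apply cell_congr
    intro a b hab k hk hk'
    by_cases hθ : a = 0 ∧ b = Fin.last (N + 1) ∧ k = m
    · obtain ⟨rfl, rfl, rfl⟩ := hθ
      rw [huθ]
      exact iff_of_true hsep le_rfl
    · have := hstrict a b hab k hk hk' hθ
      refine ⟨fun h => (this.1 h).le, fun h => ?_⟩
      by_contra! h'
      exact absurd (this.2 h') h.not_gt

/-! ### Integer and fractional parts of a facet point. -/

variable {N : ℕ}

/-- The indices of `Fin (N + 2)` other than the first and the last one. -/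
def mid (t : Fin N) : Fin (N + 2) := t.castSucc.succ

lemma mid_lt_mid {s t : Fin N} : mid s < mid t ↔ s < t := by simp [mid]

/-- Every pair `a < b` is one of `(0, last)`, `(0, mid t)`, `(mid t, last)`, `(mid s, mid t)`. -/
lemma forall_lt_of_mid {P : Fin (N + 2) → Fin (N + 2) → Prop} (h1 : P 0 (Fin.last (N + 1)))
    (h2 : ∀ t, P 0 (mid t)) (h3 : ∀ t, P (mid t) (Fin.last (N + 1)))
    (h4 : ∀ s t, s < t → P (mid s) (mid t)) (a b : Fin (N + 2)) (hab : a < b) : P a b := by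
  have hb : ∀ b : Fin (N + 2), 0 < b → b = Fin.last (N + 1) ∨ ∃ t, b = mid t := by
    intro b hb
    obtain ⟨c, rfl⟩ := Fin.exists_succ_eq.2 hb.ne'
    rcases Fin.eq_castSucc_or_eq_last c with ⟨t, rfl⟩ | rfl
    · exact Or.inr ⟨t, rfl⟩
    · exact Or.inl rfl
  rcases (Fin.zero_le a).eq_or_lt with rfl | ha
  · rcases hb b hab with rfl | ⟨t, rfl⟩
    exacts [h1, h2 t]
  · rcases hb a ha with rfl | ⟨s, rfl⟩
    · exact absurd hab (Fin.le_last b).not_gt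
    · rcases hb b (ha.trans hab) with rfl | ⟨t, rfl⟩
      exacts [h3 s, h4 s t (mid_lt_mid.1 hab)]

/-- The point `u` lies on `H_{θ,m}`, and the roots `α_{1,t}` take on it increasing values with
integer parts `f` and pairwise distinct nonzero fractional parts `y`. -/
structure HasCode (m : ℕ) (u : V (N + 2)) (f : Fin N → ℕ) (y : Fin N → ℝ) : Prop where
  m_pos : 0 < m
  gap_last : gap u 0 (Fin.last (N + 1)) = m
  gap_mid : ∀ t, gap u 0 (mid t) = f t + y t
  pos : ∀ t, 0 < y t
  lt_one : ∀ t, y t < 1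
  f_lt : ∀ t, f t < m
  inj : Function.Injective y
  mono : ∀ s t, s < t → (f s : ℝ) + y s < f t + y t

namespace HasCode

variable {u u' : V (N + 2)} {f f' : Fin N → ℕ} {y y' : Fin N → ℝ}

lemma gap_mid_last (h : HasCode m u f y) (t : Fin N) :
    gap u (mid t) (Fin.last (N + 1)) = m - (f t + y t) := by
  have := gap_add_gap u 0 (mid t) (Fin.last (N + 1))
  rw [h.gap_last, h.gap_mid] at this
  linarith

lemma gap_mid_mid (h : HasCode m u f y) (s t : Fin N) :
    gap u (mid s) (mid t) = (f t + y t) - (f s + y s) := by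
  have := gap_add_gap u 0 (mid s) (mid t)
  rw [h.gap_mid, h.gap_mid] at this
  linarith

lemma le_gap_mid_iff (h : HasCode m u f y) (t : Fin N) (k : ℤ) :
    (k : ℝ) ≤ gap u 0 (mid t) ↔ k ≤ f t := by
  have h0 := h.pos t
  have h1 := h.lt_one t
  rw [h.gap_mid]
  constructor
  · intro hk
    have : (k : ℝ) < ((f t + 1 : ℤ) : ℝ) := by push_cast; linarith
    exact Int.lt_add_one_iff.1 (by exact_mod_cast this)
  · intro hk
    have : (k : ℝ) ≤ ((f t : ℤ) : ℝ) := by exact_mod_cast hk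
    push_cast at this
    linarith

lemma le_gap_last_iff (h : HasCode m u f y) (t : Fin N) (k : ℤ) :
    (k : ℝ) ≤ gap u (mid t) (Fin.last (N + 1)) ↔ k ≤ m - 1 - f t := by
  have h0 := h.pos t
  have h1 := h.lt_one t
  rw [h.gap_mid_last]
  constructor
  · intro hk
    have : (k : ℝ) < ((m - f t : ℤ) : ℝ) := by push_cast; linarith
    have : k < m - f t := by exact_mod_cast this
    omega
  · intro hk
    have : (k : ℝ) ≤ ((m - 1 - f t : ℤ) : ℝ) := by exact_mod_cast hk
    push_cast at this
    linarith

/-- The difference of two values has floor `f t - f s` or one less, according to the order of the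
fractional parts. -/
lemma le_gap_mid_mid_iff (h : HasCode m u f y) {s t : Fin N} (hst : s ≠ t) (k : ℤ) :
    (k : ℝ) ≤ gap u (mid s) (mid t) ↔ k < f t - f s ∨ k = f t - f s ∧ y s < y t := by
  have h0 := h.pos t
  have h1 := h.lt_one t
  have h2 := h.pos s
  have h3 := h.lt_one s
  have hne : y s ≠ y t := h.inj.ne hst
  rw [h.gap_mid_mid]
  constructor
  · intro hk
    have : (k : ℝ) < ((f t - f s + 1 : ℤ) : ℝ) := by push_cast; linarith
    have : k < f t - f s + 1 := by exact_mod_cast this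
    rcases (Int.lt_add_one_iff.1 this).lt_or_eq with hlt | rfl
    · exact Or.inl hlt
    · push_cast at hk
      exact Or.inr ⟨rfl, lt_of_le_of_ne (by linarith) hne⟩
  · rintro (hk | ⟨rfl, hy⟩)
    · have : (k : ℝ) ≤ ((f t - f s - 1 : ℤ) : ℝ) := by
        exact_mod_cast Int.le_sub_one_of_lt hk
      push_cast at this
      linarith
    · push_cast
      linarith

/-- A point with a code lies in the relative interior of a facet. -/
lemma isFacetPoint (h : HasCode m u f y) : IsFacetPoint m u := by
  have hfm : ∀ t, (f t : ℝ) + 1 ≤ m := fun t => by exact_mod_cast h.f_lt t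
  refine ⟨h.gap_last, ?_, ?_⟩
  · apply forall_lt_of_mid
    · rw [h.gap_last]; exact_mod_cast h.m_pos
    · intro t
      rw [h.gap_mid]
      have := h.pos t
      positivity
    · intro t
      rw [h.gap_mid_last]
      linarith [hfm t, h.lt_one t]
    · intro s t hst
      rw [h.gap_mid_mid]
      linarith [h.mono s t hst]
  · apply forall_lt_of_mid
    · intro k _ _ hk he
      rw [h.gap_last] at he
      exact hk ⟨rfl, rfl, by exact_mod_cast he.symm⟩
    · intro t k _ _ _ he
      have h1 := (h.le_gap_mid_iff t k).1 he.ge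
      have : (k : ℝ) ≤ ((f t : ℤ) : ℝ) := by exact_mod_cast h1
      rw [h.gap_mid] at he
      push_cast at this
      linarith [h.pos t]
    · intro t k _ _ _ he
      have h1 := (h.le_gap_last_iff t k).1 he.ge
      have : (k : ℝ) ≤ ((m - 1 - f t : ℤ) : ℝ) := by exact_mod_cast h1
      rw [h.gap_mid_last] at he
      push_cast at this
      linarith [h.lt_one t]
    · intro s t hst k _ _ _ he
      rcases (h.le_gap_mid_mid_iff hst.ne k).1 he.ge with h1 | ⟨rfl, h1⟩
      · have : (k : ℝ) ≤ ((f t - f s - 1 : ℤ) : ℝ) := by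
          exact_mod_cast Int.le_sub_one_of_lt h1
        rw [h.gap_mid_mid] at he
        push_cast at this
        linarith [h.pos t, h.lt_one s]
      · rw [h.gap_mid_mid] at he
        push_cast at he
        linarith

/-- The levels of `α_{1,t}` reveal `f`. Level `f t - f s` of the root between `s` and `t` reveals
the order of `y s` and `y t`, and it is available since both integer parts are below `m`. -/
lemma cell_eq_iff (h : HasCode m u f y) (h' : HasCode m u' f' y') :
    cell m u = cell m u' ↔ f = f' ∧ ∀ s t, y s < y t ↔ y' s < y' t := by
  constructor
  · intro he
    obtain ⟨v, hv⟩ := h.isFacetPoint.cell_nonempty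
    have key : ∀ a b : Fin (N + 2), a < b → ∀ k : ℤ, -(m : ℤ) < k → k ≤ m →
        ((k : ℝ) ≤ gap u a b ↔ (k : ℝ) ≤ gap u' a b) := fun a b hab k hk hk' =>
      (le_gap_iff_of_mem_cell hv hab hk hk').symm.trans
        (le_gap_iff_of_mem_cell (he ▸ hv) hab hk hk')
    have hf : f = f' := by
      funext t
      have h1 := key 0 (mid t) (Fin.succ_pos _)
      have h2 := h.f_lt t
      have h3 := h'.f_lt t
      have h4 := h1 (f t) (by omega) (by omega)
      have h5 := h1 (f' t) (by omega) (by omega)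
      rw [h.le_gap_mid_iff, h'.le_gap_mid_iff] at h4 h5
      omega
    subst hf
    have hlt : ∀ s t, s < t → (y s < y t ↔ y' s < y' t) := by
      intro s t hst
      have h2 := h.f_lt t
      have h3 := h.f_lt s
      have := key (mid s) (mid t) (mid_lt_mid.2 hst) (f t - f s) (by omega) (by omega)
      rw [h.le_gap_mid_mid_iff hst.ne, h'.le_gap_mid_mid_iff hst.ne] at this
      simpa using this
    refine ⟨rfl, fun s t => ?_⟩
    rcases lt_trichotomy s t with hst | rfl | hst
    · exact hlt s t hst
    · simp
    · have := hlt t s hst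
      have h1 := h.inj.ne hst.ne
      have h2 := h'.inj.ne hst.ne
      rw [← not_iff_not, not_lt, not_lt, h1.le_iff_lt, h2.le_iff_lt, this]
  · rintro ⟨rfl, hy⟩
    apply cell_congr
    apply forall_lt_of_mid
    · intro k _ _
      rw [h.gap_last, h'.gap_last]
    · intro t k _ _
      rw [h.le_gap_mid_iff, h'.le_gap_mid_iff]
    · intro t k _ _
      rw [h.le_gap_last_iff, h'.le_gap_last_iff]
    · intro s t hst k _ _
      rw [h.le_gap_mid_mid_iff hst.ne, h'.le_gap_mid_mid_iff hst.ne, hy]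

end HasCode

/-- A zero fractional part, or two equal ones, would put `u` on a hyperplane other than `H_{θ,m}`.
Positivity of the gap to the last index bounds the integer parts by `m - 1`. -/
lemma IsFacetPoint.exists_hasCode {u : V (N + 2)} (hm : 1 ≤ m) (h : IsFacetPoint m u) :
    ∃ f y, HasCode m u f y := by
  set x : Fin N → ℝ := fun t => gap u 0 (mid t) with hx
  have hxpos : ∀ t, 0 < x t := fun t => h.gap_pos _ _ (Fin.succ_pos _)
  have hfl : ∀ t, ((⌊x t⌋₊ : ℤ) : ℝ) ≤ x t := fun t => by
    exact_mod_cast Nat.floor_le (hxpos t).le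
  have hmidne : ∀ t : Fin N, mid t ≠ Fin.last (N + 1) := fun t => by
    simp only [mid, ne_eq, Fin.ext_iff, Fin.val_succ, Fin.val_castSucc, Fin.val_last]
    omega
  have hfm : ∀ t, ⌊x t⌋₊ < m := fun t => by
    rw [Nat.floor_lt (hxpos t).le, ← h.gap_eq, ← gap_add_gap u 0 (mid t)]
    have := h.gap_pos (mid t) (Fin.last (N + 1)) (lt_of_le_of_ne (Fin.le_last _) (hmidne t))
    simp only [hx]
    linarith
  refine ⟨fun t => ⌊x t⌋₊, fun t => x t - ⌊x t⌋₊, hm, h.gap_eq, fun t => ?_, fun t => ?_, fun t => ?_,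
    hfm, ?_, fun s t hst => ?_⟩
  · simp [hx]
  · have := h.gap_ne 0 (mid t) (Fin.succ_pos _) ⌊x t⌋₊ (by omega) (by have := hfm t; omega)
      fun hh => hmidne t hh.2.1
    have := lt_of_le_of_ne (hfl t) this.symm
    push_cast at this
    exact sub_pos.2 this
  · have := Nat.lt_floor_add_one (x t)
    linarith
  · have key : ∀ s t, s < t → x s - ⌊x s⌋₊ ≠ x t - ⌊x t⌋₊ := by
      intro s t hst he
      have h1 := hfm s
      have h2 := hfm t
      apply h.gap_ne (mid s) (mid t) (mid_lt_mid.2 hst) (⌊x t⌋₊ - ⌊x s⌋₊) (by omega) (by omega)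
        fun hh => hmidne t hh.2.1
      have := gap_add_gap u 0 (mid s) (mid t)
      simp only [hx] at he ⊢
      push_cast
      linarith
    intro s t he
    by_contra hne
    rcases lt_or_gt_of_ne hne with hst | hst
    · exact key s t hst he
    · exact key t s hst he.symm
  · have := gap_add_gap u 0 (mid s) (mid t)
    have := h.gap_pos _ _ (mid_lt_mid.2 hst)
    simp only [hx]
    linarith

/-! ### Words as an index set for the regions. -/

/-- The letter `w_s` of a word, with the fractional part `(s + 1) / (N + 1)` marking its place. -/
noncomputable def wordVal (w : Fin N → Fin m) (s : Fin N) : ℝ :=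
  ((w s : ℕ) : ℝ) + ((s : ℝ) + 1) / (N + 1)

/-- The permutation that sorts the values of a word. -/
noncomputable def wordSort (w : Fin N → Fin m) : Equiv.Perm (Fin N) := Tuple.sort (wordVal w)

/-- The point of `H_{θ,m}` on which the roots `α_{1,t}` take the values of a word, sorted. -/
noncomputable def wordPoint (w : Fin N → Fin m) : V (N + 2) :=
  -- The sign makes the gap from index `0` equal to the listed value, since `gap` subtracts the
  -- later coordinate.
  centre fun a => -(Fin.cons 0 (Fin.snoc (wordVal w ∘ wordSort w) (m : ℝ) : Fin (N + 1) → ℝ) :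
    Fin (N + 2) → ℝ) a

lemma wordVal_injective (w : Fin N → Fin m) : Function.Injective (wordVal w) := by
  have hN : (0 : ℝ) < N + 1 := by positivity
  have key : ∀ s t : Fin N, s < t → wordVal w s ≠ wordVal w t := by
    intro s t hst he
    have hst' : (s : ℝ) < t := by exact_mod_cast hst
    have htN : (t : ℝ) < N := by exact_mod_cast t.2
    have hs0 : (0 : ℝ) ≤ (s : ℕ) := by positivity
    have h1 : (((w s : ℕ) : ℤ) - (w t : ℕ) : ℝ) = ((t : ℝ) - s) / (N + 1) := by
      unfold wordVal at he
      push_cast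
      rw [sub_div]
      rw [add_div, add_div] at he
      linarith
    have h2 : (0 : ℝ) < ((t : ℝ) - s) / (N + 1) := div_pos (by linarith) hN
    have h3 : ((t : ℝ) - s) / (N + 1) < 1 := (div_lt_one hN).2 (by linarith)
    rw [← h1] at h2 h3
    have h2' : (0 : ℤ) < ((w s : ℕ) : ℤ) - (w t : ℕ) := by exact_mod_cast h2
    have h3' : ((w s : ℕ) : ℤ) - (w t : ℕ) < 1 := by exact_mod_cast h3
    omega
  intro s t he
  by_contra hne
  rcases lt_or_gt_of_ne hne with hst | hst
  · exact key s t hst he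
  · exact key t s hst he.symm

lemma hasCode_wordPoint (hm : 1 ≤ m) (w : Fin N → Fin m) :
    HasCode m (wordPoint w) (fun t => w (wordSort w t)) fun t => ((wordSort w t : ℝ) + 1) / (N + 1) where
  m_pos := hm
  gap_last := by
    rw [wordPoint, gap_centre, ← Fin.succ_last, Fin.cons_succ, Fin.snoc_last]
    simp
  gap_mid t := by
    rw [wordPoint, gap_centre, mid, Fin.cons_succ, Fin.snoc_castSucc]
    simp [wordVal]
  pos t := by positivity
  lt_one t := by
    rw [div_lt_one (by positivity)]
    have : (wordSort w t : ℝ) < N := by exact_mod_cast (wordSort w t).2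
    linarith
  f_lt t := (w (wordSort w t)).2
  inj s t h := by
    have hN : (N : ℝ) + 1 ≠ 0 := by positivity
    have : ((wordSort w s : ℕ) : ℝ) = (wordSort w t : ℕ) := by
      simpa [div_left_inj' hN] using h
    exact (wordSort w).injective (Fin.ext (by exact_mod_cast this))
  mono s t hst := by
    have h1 : wordVal w (wordSort w s) ≤ wordVal w (wordSort w t) :=
      Tuple.monotone_sort (wordVal w) hst.le
    exact lt_of_le_of_ne h1 fun h =>
      hst.ne ((wordSort w).injective (wordVal_injective w h))

lemma wordFrac_lt_iff (i j : Fin N) :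
    ((i : ℝ) + 1) / (N + 1) < ((j : ℝ) + 1) / (N + 1) ↔ i < j := by
  rw [div_lt_div_iff_of_pos_right (by positivity)]
  simp

/-- The composite of `σ⁻¹` followed by `τ` is increasing, and the identity is the only monotone
permutation. -/
lemma perm_eq_of_lt_iff {σ τ : Equiv.Perm (Fin N)} (h : ∀ s t, σ s < σ t ↔ τ s < τ t) : σ = τ := by
  have : Monotone (σ.symm.trans τ) := by
    apply StrictMono.monotone
    intro i j hij
    have := h (σ.symm i) (σ.symm j)
    simpa using this.1 (by simpa using hij)
  have := (Equiv.Perm.monotone_iff _).1 this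
  ext t
  have := congrArg (fun e : Equiv.Perm (Fin N) => e (σ t)) this
  simpa using congrArg Fin.val this.symm

lemma cell_wordPoint_injective (hm : 1 ≤ m) :
    Function.Injective fun w : Fin N → Fin m => cell m (wordPoint w) := by
  intro w w' h
  obtain ⟨hf, hy⟩ := ((hasCode_wordPoint hm w).cell_eq_iff (hasCode_wordPoint hm w')).1 h
  have hσ : wordSort w = wordSort w' := perm_eq_of_lt_iff fun s t => by
    simpa only [wordFrac_lt_iff] using hy s t
  funext s
  have := congrFun hf ((wordSort w).symm s)
  rw [← hσ] at this
  simpa [Fin.ext_iff] using this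

/-- The fractional parts matter only through their ranks, so the one of rank `s` may be replaced by
`(s+1)/(N+1)`; the letter in place `s` is its integer part. -/
lemma HasCode.exists_word {u : V (N + 2)} {f : Fin N → ℕ} {y : Fin N → ℝ} (h : HasCode m u f y) :
    ∃ w : Fin N → Fin m, cell m (wordPoint w) = cell m u := by
  set τ := Tuple.sort y
  have hτ : StrictMono (y ∘ τ) :=
    (Tuple.monotone_sort y).strictMono_of_injective (h.inj.comp τ.injective)
  have hlt : ∀ s t, τ.symm s < τ.symm t ↔ y s < y t := fun s t => by
    rw [← hτ.lt_iff_lt]; simp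
  set w : Fin N → Fin m := fun s => ⟨f (τ s), h.f_lt _⟩ with hw
  have hval : ∀ t, wordVal w (τ.symm t) = f t + ((τ.symm t : ℝ) + 1) / (N + 1) := fun t => by
    simp [wordVal, hw]
  have hN : (0 : ℝ) < N + 1 := by positivity
  have hmono : Monotone (wordVal w ∘ τ.symm) := by
    apply StrictMono.monotone
    intro s t hst
    simp only [Function.comp_apply, hval]
    have h1 := h.mono s t hst
    have h2 := h.pos s
    have h3 := h.lt_one t
    have h4 : (f s : ℝ) < ((f t + 1 : ℕ) : ℝ) := by push_cast; linarith
    have h5 : f s < f t + 1 := by exact_mod_cast h4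
    rcases (Nat.lt_succ_iff.1 h5).lt_or_eq with hf | hf
    · have hf' : (f s : ℝ) + 1 ≤ f t := by exact_mod_cast hf
      have h6 : ((τ.symm s : ℝ) + 1) / (N + 1) < 1 := by
        rw [div_lt_one hN]
        have : (τ.symm s : ℝ) < N := by exact_mod_cast (τ.symm s).2
        linarith
      have h7 : (0 : ℝ) < ((τ.symm t : ℝ) + 1) / (N + 1) := by positivity
      linarith
    · rw [hf] at h1 ⊢
      have := (wordFrac_lt_iff (τ.symm s) (τ.symm t)).2 ((hlt s t).2 (by linarith))
      linarith
  have hσ : wordSort w = τ.symm := by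
    -- Both permutations sort `wordVal w`; its values are distinct, so the permutations agree.
    have := Tuple.unique_monotone (Tuple.monotone_sort (wordVal w)) hmono
    ext t
    exact congrArg Fin.val (wordVal_injective w (congrFun this t))
  refine ⟨w, ((hasCode_wordPoint h.m_pos w).cell_eq_iff h).2 ⟨?_, fun s t => ?_⟩⟩
  · funext t
    rw [hσ]
    simp [hw]
  · rw [wordFrac_lt_iff, hσ, hlt]

/-- The regions with separating wall `H_{θ,m}` are indexed by words. -/
lemma sepSet_eq_range (hm : 1 ≤ m) : sepSet (N + 2) m (highestRoot (N + 2)) m =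
    Set.range fun w : Fin N → Fin m => cell m (wordPoint w) := by
  apply Set.Subset.antisymm
  · intro R hR
    -- Any word serves: it only supplies the auxiliary facet point.
    have w₀ : Fin N → Fin m := fun _ => ⟨0, hm⟩
    obtain ⟨u, hu, rfl⟩ :=
      exists_facetPoint_of_mem_sepSet hm ⟨_, (hasCode_wordPoint hm w₀).isFacetPoint⟩ hR
    obtain ⟨f, y, h⟩ := hu.exists_hasCode hm
    exact h.exists_word
  · rintro _ ⟨w, rfl⟩
    exact (hasCode_wordPoint hm w).isFacetPoint.mem_sepSet hm

/-! ### The statistics `r` and `c`, and the sum over words. -/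

/-- For each root the separating levels form an initial segment `1, …, g i`. -/
lemma ncard_pairs_eq_sum {P : ℕ → ℕ → Prop} (g : Fin (N + 1) → ℕ) (hg : ∀ i, g i ≤ m)
    (hP : ∀ i : Fin (N + 1), ∀ k, 1 ≤ k → k ≤ m → (P (i + 1) k ↔ k ≤ g i)) :
    Set.ncard {x : ℕ × ℕ | (1 ≤ x.1 ∧ x.1 ≤ N + 2 - 1) ∧ (1 ≤ x.2 ∧ x.2 ≤ m) ∧ P x.1 x.2} =
      ∑ i, g i := by
  set F : (Σ _ : Fin (N + 1), ℕ) → ℕ × ℕ := fun x => (x.1 + 1, x.2) with hF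
  have hinj : Function.Injective F := by
    rintro ⟨i, k⟩ ⟨j, l⟩ h
    simp only [hF, Prod.mk.injEq, add_left_inj, Fin.val_inj] at h
    obtain ⟨rfl, rfl⟩ := h
    rfl
  have : {x : ℕ × ℕ | (1 ≤ x.1 ∧ x.1 ≤ N + 2 - 1) ∧ (1 ≤ x.2 ∧ x.2 ≤ m) ∧ P x.1 x.2} =
      F '' (Finset.univ.sigma fun i => Finset.Icc 1 (g i) : Finset (Σ _ : Fin (N + 1), ℕ)) := by
    ext ⟨i, k⟩
    simp only [Set.mem_ofPred_eq, Set.mem_image, SetLike.mem_coe, Finset.mem_sigma, Finset.mem_univ,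
      true_and, Finset.mem_Icc, Sigma.exists, hF, Prod.mk.injEq]
    constructor
    · rintro ⟨⟨hi, hi'⟩, ⟨hk, hk'⟩, h⟩
      obtain ⟨i, rfl⟩ := Nat.exists_eq_add_of_le' hi
      exact ⟨⟨i, by omega⟩, k, ⟨hk, (hP ⟨i, by omega⟩ k hk hk').1 h⟩, rfl, rfl⟩
    · rintro ⟨j, l, ⟨hl, hl'⟩, rfl, rfl⟩
      have := hg j
      exact ⟨by omega, by omega, (hP j l hl (by omega)).2 hl'⟩
  rw [this, Set.ncard_image_of_injective _ hinj, Set.ncard_coe_finset, Finset.card_sigma]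
  simp

lemma HasCode.rStat_eq {u : V (N + 2)} {f : Fin N → ℕ} {y : Fin N → ℝ} (h : HasCode m u f y) :
    rStat (N + 2) m (cell m u) = m + ∑ t, f t := by
  have hne := h.isFacetPoint.cell_nonempty
  refine (ncard_pairs_eq_sum (P := fun j k => Separates (root (N + 2) 1 j) (k : ℤ) (cell m u)
    (fundAlcove (N + 2))) (Fin.snoc f m : Fin (N + 1) → ℕ) ?_ ?_).trans ?_
  · intro i
    induction i using Fin.lastCases with
    | last => simp
    | cast t => simpa using (h.f_lt t).le
  · intro i k hk hk'
    have := separates_cell_iff hne (Fin.succ_pos i) (k := k) (by omega) (by omega)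
    simp only [Fin.val_zero, zero_add, Fin.val_succ] at this
    rw [this]
    induction i using Fin.lastCases with
    | last =>
      rw [Fin.succ_last, h.gap_last, Fin.snoc_last]
      simp
    | cast t =>
      have := h.le_gap_mid_iff t k
      rw [mid] at this
      rw [this, Fin.snoc_castSucc]
      simp
  · simp [Fin.sum_univ_castSucc, add_comm]

lemma HasCode.cStat_eq {u : V (N + 2)} {f : Fin N → ℕ} {y : Fin N → ℝ} (h : HasCode m u f y) :
    cStat (N + 2) m (cell m u) = m + ∑ t, (m - 1 - f t) := by
  have hne := h.isFacetPoint.cell_nonempty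
  refine (ncard_pairs_eq_sum (P := fun i k => Separates (root (N + 2) i (N + 2 - 1)) (k : ℤ)
    (cell m u) (fundAlcove (N + 2))) (Fin.cons m fun t => m - 1 - f t : Fin (N + 1) → ℕ)
    ?_ ?_).trans ?_
  · intro i
    induction i using Fin.cases with
    | zero => simp
    | succ t => simp only [Fin.cons_succ]; omega
  · intro i k hk hk'
    have := separates_cell_iff hne (Fin.castSucc_lt_last i) (k := k) (by omega) (by omega)
    simp only [Fin.val_castSucc, Fin.val_last] at this
    rw [show N + 2 - 1 = N + 1 from rfl, this]
    induction i using Fin.cases with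
    | zero =>
      rw [Fin.castSucc_zero, h.gap_last, Fin.cons_zero]
      simp
    | succ t =>
      have h1 := h.le_gap_last_iff t k
      have h2 := h.f_lt t
      rw [mid, Fin.succ_castSucc] at h1
      rw [h1, Fin.cons_succ]
      omega
  · simp [Fin.sum_univ_succ]

end Shi

theorem mainTheorem1 {A : Type*} [CommSemiring A] (n m : ℕ) (hn : 2 ≤ n) (hm : 1 ≤ m) (p q : A) :
    (Shi.sepSet n m (Shi.highestRoot n) (m : ℤ)).Finite ∧
    Shi.genFun n m (Shi.highestRoot n) p q =
      p ^ m * q ^ m * Shi.pqInt m p q ^ (n - 2) := by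
  obtain ⟨N, rfl⟩ := Nat.exists_eq_add_of_le' hn
  rw [Shi.genFun, Shi.sepSet_eq_range hm]
  refine ⟨Set.finite_range _, ?_⟩
  rw [finsum_mem_range (Shi.cell_wordPoint_injective hm), finsum_eq_sum_of_fintype, Nat.add_sub_cancel]
  -- The sum is reversed so that the letter `j` is the exponent of `q`, as in `r`.
  have hpq : Shi.pqInt m p q = ∑ j : Fin m, p ^ (m - 1 - (j : ℕ)) * q ^ (j : ℕ) := by
    rw [Shi.pqInt, ← Finset.sum_range_reflect, Finset.sum_range]
    refine Finset.sum_congr rfl fun j _ => ?_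
    rw [show m - 1 - (m - 1 - (j : ℕ)) = j by omega]
  rw [hpq, Fintype.sum_pow, Finset.mul_sum]
  refine Finset.sum_congr rfl fun w _ => ?_
  have h := Shi.hasCode_wordPoint hm w
  -- Sorting only permutes the letters, so both statistics are sums over the word itself.
  rw [h.cStat_eq, h.rStat_eq, Equiv.sum_comp (Shi.wordSort w) fun s => m - 1 - (w s : ℕ),
    Equiv.sum_comp (Shi.wordSort w) fun s => (w s : ℕ), Finset.prod_mul_distrib,
    Finset.prod_pow_eq_pow_sum, Finset.prod_pow_eq_pow_sum, pow_add, pow_add]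
  ring
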